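/- Let $c>0$, $\varepsilon>1$, $\sigma\ge 0$, and put $$r=\frac{4\pi\sigma}{c\,\varepsilon},\qquad q=\frac{2\pi\sigma}{c(\varepsilon-1)},\qquad \tilde\varepsilon(k)=\varepsilon+\frac{4\pi i\sigma}{kc}\quad(k\in\mathbb R\setminus\{0\}).$$ Let $h:\mathbb R\to\mathbb R$ be differentiable at a point $x$, let $\tilde f:\mathbb R\to\mathbb C$ be a spectrum and $u(x,z,k)$ complex amplitudes (for instance solutions of the parabolic equation $2ik\,u_x+u_{zz}=0$ in $z>h(x)$; the equation itself is not needed), and consider the wave packet $$\Pi(x,z,s)=\frac1{2\pi}\int_{-\infty}^{\infty}\tilde f(k)\,u(x,z,k)\,e^{-iks}\,dk,\qquad z\ge h(x).$$ Below, $z$-derivatives at $z=h(x)$ are one-sided, from $z\ge h(x)$. Assume that at this $x$: 1. for every $z\ge h(x)$, $\tilde f\,u(x,z,\cdot)$ and $\Pi(x,z,\cdot)$ are integrable on $\mathbb R$, and $\Pi(x,z,s)=0$ for $s<0$ (causality); 2. $\Pi(x,h(x),\cdot)$ is locally absolutely continuous with derivative $\Pi_s(x,h(x),\cdot)\in L^1(\mathbb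 R)$; 3. for a.e. $k$ with $\tilde f(k)\neq0$, $\partial u/\partial z$ exists at $z=h(x)$; for a.e. $s$, $\partial\Pi/\partial z$ exists at $z=h(x)$; and there is $G\in L^1(\mathbb R)$ such that for all $z>h(x)$ close to $h(x)$, $|\Pi(x,z,s)-\Pi(x,h(x),s)|\le (z-h(x))\,G(s)$ for a.e. $s$. Consider the dispersive impedance condition $$\frac{\partial u}{\partial z}+ik\left[\frac{\sqrt{\varepsilon-1}}{\varepsilon}\,\frac{\sqrt{k(k+2iq)}}{k+ir}-h'(x)\right]u=0,\qquad z=h(x), \tag{A}$$ where $\sqrt{k(k+2iq)}=k\sqrt{1+2iq/k}$ with the principal root; for $k\ne0$ the factor $\frac{\sqrt{\varepsilon-1}}{\varepsilon}\frac{\sqrt{k(k+2iq)}}{k+ir}$ is $\sqrt{\tilde\varepsilon(k)-1}\,/\,\tilde\varepsilon(k)$ with the principal root. Consider also the nonlocal time-domain condition $$\frac{\partial\Pi}{\partial z}(x,h,s)+h'(x)\,\frac{\partial\Pi}{\partial s}(x,h,s)=\frac{\sqrt{\varepsilon-1}}{\varepsilon}\left[\frac{\partial\Pi}{\partial s}(x,h,s)-\int_0^s\frac{\partial\Pi}{\partial\eta}(x,h,\eta)\,N(s-\eta)\,d\eta\right],\tag{B}$$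 where $h=h(x)$, $$N(s)=e^{-rs}\left[q\int_0^s e^{(r-q)t}I_1(qt)\,\frac{dt}{t}+r-q\right],$$ and $I_1$ is the modified Bessel function of the first kind of order one. Then: * the integral in the definition of $N(s)$ and the integral in (B) converge absolutely for every $s$; * (A) holds for almost every $k$ with $\tilde f(k)\ne0$ if and only if (B) holds for almost every $s$; * if (A) holds for almost every $k$ with $\tilde f(k)\ne0$, then (B) holds at every $s$ at which $\Pi_s(x,h(x),\cdot)$ and $\Pi_z(x,h(x),\cdot)$ are continuous (where a derivative does not exist, it is given the value $0$). -/

import Mathlib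

open MeasureTheory Filter Topology Set

noncomputable section

namespace NonlocalImpedance

/-- Complex permittivity of the ground at wave number `k` (Gaussian units):
`ε + 4 π i σ / (k c)`. -/
def permittivity (c ε σ k : ℝ) : ℂ :=
  (ε : ℂ) + 4 * (Real.pi : ℂ) * Complex.I * (σ : ℂ) / ((k : ℂ) * (c : ℂ))

/-- The parameter `r = 4 π σ / (c ε)`. -/
def rParam (c ε σ : ℝ) : ℝ := 4 * Real.pi * σ / (c * ε)

/-- The parameter `q = 2 π σ / (c (ε - 1))`. -/
def qParam (c ε σ : ℝ) : ℝ := 2 * Real.pi * σ / (c * (ε - 1))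

/-- The branch of `√(k (k + 2 i q))` on the real axis which is the boundary value of the branch
that is holomorphic in the upper half-plane and asymptotic to `k` at infinity, namely
`k √(1 + 2 i q / k)` with the principal square root. -/
def dispersiveRoot (q k : ℝ) : ℂ :=
  (k : ℂ) * (1 + 2 * Complex.I * (q : ℂ) / (k : ℂ)) ^ (1 / 2 : ℂ)

theorem dispersiveRoot_sq (q k : ℝ) (hk : k ≠ 0) :
    dispersiveRoot q k ^ 2 = (k : ℂ) * ((k : ℂ) + 2 * Complex.I * (q : ℂ)) := by
  have hk' : (k : ℂ) ≠ 0 := by exact_mod_cast hk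
  unfold dispersiveRoot
  rw [mul_pow, ← Complex.cpow_nat_mul]
  norm_num
  field_simp

/-- The dispersive surface factor
`(√(ε - 1) / ε) · √(k (k + 2 i q)) / (k + i r)`. -/
def surfaceFactor (c ε σ k : ℝ) : ℂ :=
  ((Real.sqrt (ε - 1) / ε : ℝ) : ℂ) * (dispersiveRoot (qParam c ε σ) k /
    ((k : ℂ) + Complex.I * (rParam c ε σ : ℂ)))

/-- The surface factor is `√(ε̃ - 1) / ε̃` with the principal square root, where `ε̃` is the complex
permittivity. -/
theorem surfaceFactor_eq (c ε σ k : ℝ) (hc : 0 < c) (hε : 1 < ε) (hk : k ≠ 0) :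
    surfaceFactor c ε σ k =
      (permittivity c ε σ k - 1) ^ (1 / 2 : ℂ) / permittivity c ε σ k := by
  have hk' : (k : ℂ) ≠ 0 := by exact_mod_cast hk
  have hc' : (c : ℂ) ≠ 0 := by exact_mod_cast hc.ne'
  have hε0 : (ε : ℂ) ≠ 0 := by exact_mod_cast (by linarith : ε ≠ 0)
  have hε1 : (ε : ℂ) - 1 ≠ 0 := by exact_mod_cast (by linarith : ε - 1 ≠ 0)
  have h1 : permittivity c ε σ k - 1 =
      ((ε - 1 : ℝ) : ℂ) * (1 + 2 * Complex.I * (qParam c ε σ : ℂ) / (k : ℂ)) := by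
    unfold permittivity qParam
    push_cast
    field_simp
    ring
  have h2 : permittivity c ε σ k =
      (ε : ℂ) * ((k : ℂ) + Complex.I * (rParam c ε σ : ℂ)) / (k : ℂ) := by
    unfold permittivity rParam
    push_cast
    field_simp
  have h3 : (permittivity c ε σ k - 1) ^ (1 / 2 : ℂ) = ((Real.sqrt (ε - 1) : ℝ) : ℂ) *
      (1 + 2 * Complex.I * (qParam c ε σ : ℂ) / (k : ℂ)) ^ (1 / 2 : ℂ) := by
    have hp : 0 < ε - 1 := by linarith
    have hw : 1 + 2 * Complex.I * (qParam c ε σ : ℂ) / (k : ℂ) ≠ 0 := by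
      intro h0
      have h00 := congrArg Complex.re h0
      rw [show 2 * Complex.I * (qParam c ε σ : ℂ) / (k : ℂ) =
        ((2 * qParam c ε σ / k : ℝ) : ℂ) * Complex.I by push_cast; ring] at h00
      simp at h00
    have hpc : ((ε - 1 : ℝ) : ℂ) ≠ 0 := by exact_mod_cast hp.ne'
    rw [h1, Complex.cpow_def_of_ne_zero (mul_ne_zero hpc hw), Complex.log_ofReal_mul hp hw,
      add_mul, Complex.exp_add, Complex.ofReal_log hp.le, ← Complex.cpow_def_of_ne_zero hpc,
      ← Complex.cpow_def_of_ne_zero hw, Real.sqrt_eq_rpow, Complex.ofReal_cpow hp.le]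
    norm_num
  rw [h3, h2]
  unfold surfaceFactor dispersiveRoot
  push_cast
  rw [div_div_eq_mul_div]
  simp only [div_eq_mul_inv, mul_inv]
  ring

/-- The wave packet
`Π(x, z, s) = (1 / 2π) ∫ f̃(k) u(x, z, k) exp(-i k s) dk`. -/
def packet (f : ℝ → ℂ) (u : ℝ → ℝ → ℝ → ℂ) (x z s : ℝ) : ℂ :=
  (1 / (2 * Real.pi) : ℂ) *
    ∫ k : ℝ, f k * u x z k * Complex.exp (-(Complex.I * (k : ℂ) * (s : ℂ)))

/-- The boundary trace `∂Π/∂s (x, h(x), s)`. -/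
def packetDerivS (f : ℝ → ℂ) (u : ℝ → ℝ → ℝ → ℂ) (h : ℝ → ℝ) (x s : ℝ) : ℂ :=
  deriv (fun s' => packet f u x (h x) s') s

/-- The boundary trace `∂Π/∂z (x, h(x), s)`: a one-sided derivative, as the wave field lives in
`z ≥ h(x)`. -/
def packetDerivZ (f : ℝ → ℂ) (u : ℝ → ℝ → ℝ → ℂ) (h : ℝ → ℝ) (x s : ℝ) : ℂ :=
  derivWithin (fun z => packet f u x z s) (Ici (h x)) (h x)

/-- The wave packet with spectrum `f` and amplitude `u` is causal above the boundary point
`(x, h(x))`, and it is regular enough for its Fourier representation, for the inverse Fourier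
representation, and for the boundary derivatives of `u` and of the packet to make sense. -/
structure IsCausalPacket (f : ℝ → ℂ) (u : ℝ → ℝ → ℝ → ℂ) (h : ℝ → ℝ) (x : ℝ) : Prop where
  /-- The Fourier integral that defines the packet converges absolutely. -/
  integrable_spectrum : ∀ z, h x ≤ z → Integrable (fun k : ℝ => f k * u x z k)
  /-- Each signal is integrable, so that the inverse Fourier integral converges absolutely. -/
  integrable_signal : ∀ z, h x ≤ z → Integrable (fun s : ℝ => packet f u x z s)
  /-- Causality. -/
  causal : ∀ z, h x ≤ z → ∀ s, s < 0 → packet f u x z s = 0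
  /-- The boundary signal is locally absolutely continuous ... -/
  absolutelyContinuous : ∀ a b : ℝ,
    AbsolutelyContinuousOnInterval (fun s => packet f u x (h x) s) a b
  /-- ... with an integrable derivative. -/
  integrable_derivS : Integrable (fun s : ℝ => packetDerivS f u h x s)
  /-- The components present in the packet have a `z`-derivative at the boundary. -/
  differentiable_amplitude : ∀ᵐ k : ℝ, f k ≠ 0 →
    DifferentiableWithinAt ℝ (fun z => u x z k) (Ici (h x)) (h x)
  /-- The packet has a `z`-derivative at the boundary for almost every `s` ... -/
  differentiable_packet : ∀ᵐ s : ℝ,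
    DifferentiableWithinAt ℝ (fun z => packet f u x z s) (Ici (h x)) (h x)
  /-- ... and its difference quotients are dominated by an integrable function. -/
  dominated : ∃ G : ℝ → ℝ, Integrable G ∧ ∀ᶠ z in 𝓝[>] (h x), ∀ᵐ s : ℝ,
    ‖packet f u x z s - packet f u x (h x) s‖ ≤ (z - h x) * G s

/-- The dispersive impedance condition at `z = h(x)` for the component of wave number `k`. -/
def ImpedanceCondition (c ε σ : ℝ) (h : ℝ → ℝ) (u : ℝ → ℝ → ℝ → ℂ) (x k : ℝ) : Prop :=
  derivWithin (fun z => u x z k) (Ici (h x)) (h x) +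
    Complex.I * (k : ℂ) * (surfaceFactor c ε σ k - ((deriv h x : ℝ) : ℂ)) * u x (h x) k = 0

/-- Term of the power series of the modified Bessel function `I₁`. -/
def besselTerm (t : ℝ) (m : ℕ) : ℝ :=
  (t / 2) ^ (2 * m + 1) / ((m.factorial : ℝ) * ((m + 1).factorial : ℝ))

theorem summable_besselTerm (t : ℝ) : Summable (besselTerm t) := by
  have h := (Real.summable_pow_div_factorial ((t / 2) ^ 2)).mul_left |t / 2|
  refine Summable.of_norm_bounded h (fun m => ?_)
  have hm : (0 : ℝ) < (m.factorial : ℝ) := by exact_mod_cast m.factorial_pos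
  have hm1 : (1 : ℝ) ≤ ((m + 1).factorial : ℝ) := by exact_mod_cast (m + 1).factorial_pos
  have he : |t / 2| ^ (2 * m + 1) = |t / 2| * ((t / 2) ^ 2) ^ m := by
    rw [pow_succ, pow_mul, sq_abs, mul_comm]
  rw [besselTerm, Real.norm_eq_abs, abs_div, abs_pow, he,
    abs_of_pos (by positivity : (0 : ℝ) < (m.factorial : ℝ) * ((m + 1).factorial : ℝ)),
    ← mul_div_assoc]
  refine div_le_div_of_nonneg_left (by positivity) hm ?_
  nlinarith

/-- The modified Bessel function of the first kind of order one,
`I₁(t) = ∑ (t/2)^(2m+1) / (m! (m+1)!)`. -/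
def besselI1 (t : ℝ) : ℝ := ∑' m : ℕ, besselTerm t m

/-- The integrand `exp((r - q) t) I₁(q t) / t` in the memory kernel. -/
def kernelIntegrand (c ε σ t : ℝ) : ℝ :=
  Real.exp ((rParam c ε σ - qParam c ε σ) * t) * besselI1 (qParam c ε σ * t) / t

/-- The memory kernel
`N(s) = exp(-r s) [q ∫₀ˢ exp((r - q) t) I₁(q t) dt / t + r - q]`. -/
def memoryKernel (c ε σ s : ℝ) : ℝ :=
  Real.exp (-(rParam c ε σ * s)) *
    (qParam c ε σ * (∫ t in (0 : ℝ)..s, kernelIntegrand c ε σ t) +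
      rParam c ε σ - qParam c ε σ)

/-- The nonlocal time-domain boundary condition at `z = h(x)` and at the instant `s`. -/
def TimeDomainCondition (c ε σ : ℝ) (h : ℝ → ℝ) (f : ℝ → ℂ) (u : ℝ → ℝ → ℝ → ℂ)
    (x s : ℝ) : Prop :=
  packetDerivZ f u h x s + ((deriv h x : ℝ) : ℂ) * packetDerivS f u h x s =
    ((Real.sqrt (ε - 1) / ε : ℝ) : ℂ) * (packetDerivS f u h x s -
      ∫ η in (0 : ℝ)..s, packetDerivS f u h x η * (memoryKernel c ε σ (s - η) : ℂ))

end NonlocalImpedance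

end

/-!
Everything is read through the transform `ĝ(k) = ∫ exp(i k s) g(s) ds` (`timeFourier`), which
inverts the synthesis integral of the packet: at each height the transform of `Π` is `f̃ u` for
almost every `k` (`timeFourier_packet`), with no continuity of `f̃ u` in `k`. At the boundary,
`∂/∂s` becomes multiplication by `-i k`, because the signal is absolutely continuous and vanishes
at infinity, and `∂/∂z` passes through the transform by dominated convergence. Hence `f̃` times the
left-hand side of the impedance condition is `Π̂_z - S Π̂_s + h' Π̂_s`, with `S` the surface
factor.

The point is that `S = κ (1 - N̂)` with `κ = √(ε - 1) / ε` and `N` the memory kernel on `s > 0`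
(`surfaceFactor_eq_timeFourier`). The kernel is the convolution of the density
`M(t) = q exp(-q t) I₁(q t) / t` with `exp(-r s)`, plus `(r - q) exp(-r s)`; it vanishes if
`σ = 0`. For `σ > 0`, integrating the power series of `M` term by term gives, with `P = q - i k`,
the series `(q² / 2P) ∑ Cₘ (q / 2P)^(2m)` over the Catalan numbers `Cₘ`. It converges absolutely
since `|P| ≥ q` and `∑ Cₘ / 4^m ≤ 2` by telescoping; this also shows that `M` is integrable. The
functional equation `C = 1 + y C²` of the generating function then identifies `P - M̂` as a square
root of `P² - q² = -k (k + 2 i q)`, and the bound by `2` places it in the right half-plane, which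
selects the branch of `dispersiveRoot` (`timeFourier_causalDensity`).

As the packet is causal, the memory integral is the convolution of `Π_s` with the causal kernel, so
the weighted impedance defect is exactly the transform of the integrable defect of the time-domain
condition, and injectivity of the transform gives the equivalence. The memory integral is
continuous in `s`, so where `Π_s` and `Π_z` are continuous the almost everywhere identity holds
pointwise.
-/

namespace NonlocalImpedance

open scoped FourierTransform ContDiff Convolution

/-! ### The Fourier transform with phase `exp (i k s)` -/

/-- The Fourier transform `∫ exp(i k s) g(s) ds` of a signal `g`, with the sign and the
normalisation that invert the synthesis integral `packet`. -/
noncomputable def timeFourier (g : ℝ → ℂ) (k : ℝ) : ℂ :=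
  ∫ s : ℝ, Complex.exp (Complex.I * (k : ℂ) * (s : ℂ)) * g s

theorem timeFourier_eq_fourier (g : ℝ → ℂ) (k : ℝ) :
    timeFourier g k = 𝓕 g (-(k / (2 * Real.pi))) := by
  rw [Real.fourier_real_eq_integral_exp_smul, timeFourier]
  refine integral_congr_ae (Eventually.of_forall fun s => ?_)
  have hπ : (Real.pi : ℂ) ≠ 0 := by exact_mod_cast Real.pi_ne_zero
  simp only [smul_eq_mul]
  congr 2
  push_cast
  field_simp

theorem norm_phase (k s : ℝ) : ‖Complex.exp (Complex.I * (k : ℂ) * (s : ℂ))‖ = 1 := by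
  rw [show Complex.I * (k : ℂ) * (s : ℂ) = ((k * s : ℝ) : ℂ) * Complex.I by push_cast; ring]
  exact Complex.norm_exp_ofReal_mul_I _

theorem integrable_phase_mul {g : ℝ → ℂ} (hg : Integrable g) (k : ℝ) :
    Integrable fun s : ℝ => Complex.exp (Complex.I * (k : ℂ) * (s : ℂ)) * g s :=
  hg.bdd_mul (c := 1) (by fun_prop) (Eventually.of_forall fun s => (norm_phase k s).le)

theorem timeFourier_add {f g : ℝ → ℂ} (hf : Integrable f) (hg : Integrable g) (k : ℝ) :
    timeFourier (fun s => f s + g s) k = timeFourier f k + timeFourier g k := by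
  simp only [timeFourier, mul_add]
  exact integral_add (integrable_phase_mul hf k) (integrable_phase_mul hg k)

theorem timeFourier_sub {f g : ℝ → ℂ} (hf : Integrable f) (hg : Integrable g) (k : ℝ) :
    timeFourier (fun s => f s - g s) k = timeFourier f k - timeFourier g k := by
  simp only [timeFourier, mul_sub]
  exact integral_sub (integrable_phase_mul hf k) (integrable_phase_mul hg k)

theorem timeFourier_const_mul (a : ℂ) (g : ℝ → ℂ) (k : ℝ) :
    timeFourier (fun s => a * g s) k = a * timeFourier g k := by
  simp only [timeFourier, mul_left_comm _ a]
  exact integral_const_mul _ _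

theorem timeFourier_congr_ae {f g : ℝ → ℂ} (hfg : f =ᵐ[volume] g) (k : ℝ) :
    timeFourier f k = timeFourier g k := by
  refine integral_congr_ae ?_
  filter_upwards [hfg] with s hs
  rw [hs]

theorem continuous_timeFourier {g : ℝ → ℂ} (hg : Integrable g) : Continuous (timeFourier g) := by
  refine continuous_of_dominated (bound := fun s => ‖g s‖)
    (fun k => (integrable_phase_mul hg k).aestronglyMeasurable) (fun k => ?_) hg.norm
    (Eventually.of_forall fun s => by fun_prop)
  exact Eventually.of_forall fun s => by rw [norm_mul, norm_phase, one_mul]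

theorem timeFourier_convolution {f g : ℝ → ℂ} (hf : Integrable f) (hg : Integrable g) (k : ℝ) :
    timeFourier (convolution f g (ContinuousLinearMap.mul ℂ ℂ)) k =
      timeFourier f k * timeFourier g k := by
  simp only [timeFourier_eq_fourier]
  exact Real.fourier_mul_convolution_eq hf hg _

theorem continuous_fourier_of_integrable {g : ℝ → ℂ} (hg : Integrable g) : Continuous (𝓕 g) :=
  VectorFourier.fourierIntegral_continuous Real.continuous_fourierChar
    (L := innerₗ ℝ) continuous_inner hg

/-- Fourier inversion almost everywhere, for an integrable function with integrable transform.
No continuity is assumed: both sides have the same integral against every test function. -/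
theorem fourierInv_fourier_ae_eq {g : ℝ → ℂ} (hg : Integrable g) (hg' : Integrable (𝓕 g)) :
    g =ᵐ[volume] 𝓕⁻ (𝓕 g) := by
  have hcont : Continuous (𝓕⁻ (𝓕 g)) := by
    have : (𝓕⁻ (𝓕 g) : ℝ → ℂ) = fun w => 𝓕 (𝓕 g) (-w) :=
      funext fun w => Real.fourierInv_eq_fourier_neg _ _
    rw [this]
    exact (continuous_fourier_of_integrable hg').comp continuous_neg
  refine ae_eq_of_integral_contDiff_smul_eq hg.locallyIntegrable hcont.locallyIntegrable ?_
  intro φ hφ hφc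
  have hc : HasCompactSupport (Complex.ofRealCLM ∘ φ) := hφc.comp_left rfl
  have hd : ContDiff ℝ ∞ (Complex.ofRealCLM ∘ φ) := by fun_prop
  let Φ : SchwartzMap ℝ ℂ := hc.toSchwartzMap hd
  have hΦ : ∀ s, Φ s = (φ s : ℂ) := fun s => rfl
  have flip : ∀ {a b : ℝ → ℂ}, Integrable a → Integrable b →
      ∫ w, 𝓕 a w * b w = ∫ s, a s * 𝓕 b s := fun ha hb => by
    simpa using! VectorFourier.integral_fourierIntegral_smul_eq_flip (L := innerₗ ℝ)
      Real.continuous_fourierChar continuous_inner ha hb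
  let Ψ : SchwartzMap ℝ ℂ := 𝓕⁻ Φ
  have hinv : (𝓕 (⇑Ψ) : ℝ → ℂ) = Φ := by
    rw [← SchwartzMap.fourier_coe, FourierTransform.fourier_fourierInv_eq]
  have hinv' : (𝓕 (fun s => Φ (-s)) : ℝ → ℂ) = Ψ := by
    rw [SchwartzMap.fourierInv_coe, Real.fourierInv_eq_fourier_comp_neg]
  calc ∫ s, φ s • g s = ∫ s, 𝓕 (⇑Ψ) s * g s := by
        rw [hinv]; simp [hΦ]
    _ = ∫ s, 𝓕 (fun s => Φ (-s)) s * 𝓕 g s := by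
        rw [flip Ψ.integrable hg, hinv']
    _ = ∫ s, Φ (-s) * 𝓕 (𝓕 g) s := flip Φ.integrable.comp_neg hg'
    _ = ∫ s, Φ s * 𝓕 (𝓕 g) (-s) := by
        rw [← integral_neg_eq_self]; simp
    _ = ∫ s, φ s • 𝓕⁻ (𝓕 g) s := by
        refine integral_congr_ae (Eventually.of_forall fun s => ?_)
        simp [hΦ, Real.fourierInv_eq_fourier_neg]

/-- The transform is injective on integrable signals. -/
theorem ae_eq_zero_of_timeFourier_eq_zero {g : ℝ → ℂ} (hg : Integrable g)
    (h0 : ∀ k, timeFourier g k = 0) : g =ᵐ[volume] 0 := by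
  have hF : (𝓕 g : ℝ → ℂ) = 0 := funext fun w => by
    have := h0 (-(2 * Real.pi * w))
    rw [timeFourier_eq_fourier] at this
    rw [show -(-(2 * Real.pi * w) / (2 * Real.pi)) = w by field_simp] at this
    exact this
  have h := fourierInv_fourier_ae_eq hg (by rw [hF]; exact integrable_zero _ _ _)
  rw [hF] at h
  filter_upwards [h] with s hs
  rw [hs, Real.fourierInv_eq]
  simp

/-! ### The boundary signal and its transform -/

theorem packet_eq_fourier (f : ℝ → ℂ) (u : ℝ → ℝ → ℝ → ℂ) (x z s : ℝ) :
    packet f u x z s =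
      (1 / (2 * Real.pi) : ℂ) * 𝓕 (fun k => f k * u x z k) (s / (2 * Real.pi)) := by
  rw [Real.fourier_real_eq_integral_exp_smul, packet]
  congr 1
  refine integral_congr_ae (Eventually.of_forall fun k => ?_)
  have hπ : (Real.pi : ℂ) ≠ 0 := by exact_mod_cast Real.pi_ne_zero
  simp only [smul_eq_mul]
  rw [mul_comm]
  congr 2
  push_cast
  field_simp

/-- The transform of the packet recovers the weighted amplitudes. -/
theorem timeFourier_packet {f : ℝ → ℂ} {u : ℝ → ℝ → ℝ → ℂ} {x z : ℝ}
    (hf : Integrable fun k : ℝ => f k * u x z k) (hs : Integrable fun s => packet f u x z s) :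
    ∀ᵐ k : ℝ, timeFourier (fun s => packet f u x z s) k = f k * u x z k := by
  set g : ℝ → ℂ := fun k => f k * u x z k with hg
  have hπ : (2 * Real.pi : ℝ) ≠ 0 := by positivity
  have hπ' : (Real.pi : ℂ) ≠ 0 := by exact_mod_cast Real.pi_ne_zero
  have hFg : ∀ v, 𝓕 g v = (2 * Real.pi : ℂ) * packet f u x z (v * (2 * Real.pi)) := fun v => by
    rw [packet_eq_fourier, mul_div_cancel_right₀ _ hπ]
    field_simp
    rfl
  have hFint : Integrable (𝓕 g) := by
    have : (𝓕 g : ℝ → ℂ) = fun v => (2 * Real.pi : ℂ) * packet f u x z (v * (2 * Real.pi)) :=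
      funext hFg
    rw [this]
    exact (hs.comp_mul_right' hπ).const_mul _
  filter_upwards [fourierInv_fourier_ae_eq hf hFint] with k hk
  change _ = g k
  rw [hk, Real.fourierInv_eq_fourier_neg, Real.fourier_real_eq_integral_exp_smul, timeFourier]
  simp only [hFg]
  have key : ∀ v : ℝ, Complex.exp (((-2 * Real.pi * v * -k : ℝ) : ℂ) * Complex.I) •
      ((2 * Real.pi : ℂ) * packet f u x z (v * (2 * Real.pi))) =
      (2 * Real.pi : ℂ) * (fun s : ℝ => Complex.exp (Complex.I * (k : ℂ) * (s : ℂ)) *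
        packet f u x z s) (v * (2 * Real.pi)) := fun v => by
    simp only [smul_eq_mul]
    rw [mul_left_comm]
    congr 3
    push_cast
    ring
  rw [integral_congr_ae (Eventually.of_forall key), integral_const_mul,
    Measure.integral_comp_mul_right (fun s : ℝ => Complex.exp (Complex.I * (k : ℂ) * (s : ℂ)) *
      packet f u x z s), abs_of_pos (by positivity),
    Complex.real_smul, ← mul_assoc]
  push_cast
  rw [mul_inv_cancel₀ (by simp [hπ']), one_mul]

/-! ### Transforms of the boundary derivatives -/

theorem ae_differentiableAt_of_absolutelyContinuous {g : ℝ → ℂ}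
    (hac : ∀ a b : ℝ, AbsolutelyContinuousOnInterval g a b) :
    ∀ᵐ s : ℝ, DifferentiableAt ℝ g s := by
  have h : ∀ᵐ s : ℝ, ∀ n : ℕ, s ∈ uIcc (-(n : ℝ)) n → DifferentiableAt ℝ g s :=
    ae_all_iff.2 fun n => (hac _ _).boundedVariationOn.ae_differentiableAt_of_mem_uIcc
  filter_upwards [h] with s hs
  obtain ⟨n, hn⟩ := exists_nat_ge |s|
  exact hs n (by rw [uIcc_of_le (by linarith [abs_nonneg s])]; exact abs_le.1 hn)

theorem _root_.AbsolutelyContinuousOnInterval.comp_continuousLinearMap {E F : Type*}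
    [NormedAddCommGroup E] [NormedSpace ℝ E] [NormedAddCommGroup F] [NormedSpace ℝ F]
    {g : ℝ → E} {a b : ℝ} (hg : AbsolutelyContinuousOnInterval g a b) (L : E →L[ℝ] F) :
    AbsolutelyContinuousOnInterval (fun s => L (g s)) a b := by
  refine squeeze_zero (fun t => Finset.sum_nonneg fun i _ => dist_nonneg) (fun t => ?_)
    (by simpa using Tendsto.const_mul ‖L‖ hg)
  rw [Finset.mul_sum]
  exact Finset.sum_le_sum fun i _ => L.lipschitz.dist_le_mul _ _

/-- The fundamental theorem of calculus for absolutely continuous functions, complex-valued. -/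
theorem integral_deriv_eq_sub_of_absolutelyContinuous {g : ℝ → ℂ}
    (hac : ∀ a b : ℝ, AbsolutelyContinuousOnInterval g a b) {a b : ℝ}
    (hint : IntervalIntegrable (deriv g) volume a b) :
    ∫ s in a..b, deriv g s = g b - g a := by
  have part : ∀ L : ℂ →L[ℝ] ℝ, L (∫ s in a..b, deriv g s) = L (g b - g a) := fun L => by
    rw [← L.intervalIntegral_comp_comm hint, map_sub,
      ← ((hac a b).comp_continuousLinearMap L).integral_deriv_eq_sub]
    refine intervalIntegral.integral_congr_ae ?_
    filter_upwards [ae_differentiableAt_of_absolutelyContinuous hac] with s hs _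
    exact (L.hasFDerivAt.comp_hasDerivAt s hs.hasDerivAt).deriv.symm
  exact Complex.ext (part Complex.reCLM) (part Complex.imCLM)

/-- The transform turns `d/ds` into multiplication by `-i k`. -/
theorem timeFourier_deriv {g : ℝ → ℂ} (hac : ∀ a b : ℝ, AbsolutelyContinuousOnInterval g a b)
    (hg : Integrable g) (hg' : Integrable (deriv g)) (h0 : Tendsto g (cocompact ℝ) (𝓝 0)) (k : ℝ) :
    timeFourier (deriv g) k = -(Complex.I * (k : ℂ)) * timeFourier g k := by
  let e : ℝ → ℂ := fun s => Complex.exp (Complex.I * (k : ℂ) * (s : ℂ))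
  have he : ∀ s, HasDerivAt e (e s * (Complex.I * k)) s := fun s => by
    have := ((hasDerivAt_id s).ofReal_comp.const_mul (Complex.I * (k : ℂ))).cexp
    simpa [e] using this
  have heC : ContDiff ℝ 1 e := by
    have : ContDiff ℝ 1 (fun s : ℝ => (s : ℂ)) := Complex.ofRealCLM.contDiff
    exact (contDiff_const.mul this).cexp
  have hac' : ∀ a b : ℝ, AbsolutelyContinuousOnInterval (fun s => e s * g s) a b := fun a b =>
    (heC.contDiffOn.absolutelyContinuousOnInterval).smul (hac a b)
  have hderiv : deriv (fun s => e s * g s) =ᵐ[volume]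
      fun s => e s * deriv g s + (Complex.I * k) * (e s * g s) := by
    filter_upwards [ae_differentiableAt_of_absolutelyContinuous hac] with s hs
    rw [((he s).fun_mul hs.hasDerivAt).deriv]
    ring
  have hi1 := integrable_phase_mul hg' k
  have hi2 := (integrable_phase_mul hg k).const_mul (Complex.I * (k : ℂ))
  have hint : Integrable (deriv fun s => e s * g s) := (hi1.add hi2).congr hderiv.symm
  have hnorm : ∀ s, ‖e s * g s‖ = ‖g s‖ := fun s => by rw [norm_mul, norm_phase, one_mul]
  have hlim : Tendsto (fun s => e s * g s) (cocompact ℝ) (𝓝 0) := by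
    rw [tendsto_zero_iff_norm_tendsto_zero] at h0 ⊢
    simpa only [hnorm] using h0
  have htop : Tendsto (fun n : ℝ => e n * g n - e (-n) * g (-n)) atTop (𝓝 (0 - 0)) :=
    (hlim.mono_left atTop_le_cocompact).sub
      ((hlim.mono_left atBot_le_cocompact).comp tendsto_neg_atTop_atBot)
  have hI : ∫ s, deriv (fun s => e s * g s) s = 0 := by
    refine tendsto_nhds_unique (intervalIntegral_tendsto_integral hint tendsto_neg_atTop_atBot
      tendsto_id) ?_
    rw [sub_zero] at htop
    refine htop.congr fun n => ?_
    exact (integral_deriv_eq_sub_of_absolutelyContinuous hac' hint.intervalIntegrable).symm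
  rw [integral_congr_ae hderiv, integral_add hi1 hi2, integral_const_mul] at hI
  change timeFourier (deriv g) k + Complex.I * k * timeFourier g k = 0 at hI
  linear_combination hI

/-- The Riemann-Lebesgue lemma: the boundary terms of an integration by parts vanish. -/
theorem tendsto_packet_cocompact (f : ℝ → ℂ) (u : ℝ → ℝ → ℝ → ℂ) (x z : ℝ) :
    Tendsto (fun s => packet f u x z s) (cocompact ℝ) (𝓝 0) := by
  have h1 : Tendsto (fun s : ℝ => s / (2 * Real.pi)) (cocompact ℝ) (cocompact ℝ) :=
    (Homeomorph.mulRight₀ (2 * Real.pi)⁻¹ (by positivity)).isClosedEmbedding.tendsto_cocompact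
  have h2 := ((Real.zero_at_infty_fourier fun k => f k * u x z k).comp h1).const_mul
    (1 / (2 * Real.pi) : ℂ)
  simpa only [packet_eq_fourier, mul_zero] using! h2

variable {f : ℝ → ℂ} {u : ℝ → ℝ → ℝ → ℂ} {h : ℝ → ℝ} {x : ℝ}

theorem IsCausalPacket.timeFourier_derivS (hp : IsCausalPacket f u h x) :
    ∀ᵐ k : ℝ, timeFourier (packetDerivS f u h x) k =
      -(Complex.I * (k : ℂ)) * (f k * u x (h x) k) := by
  filter_upwards [timeFourier_packet (hp.integrable_spectrum _ le_rfl)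
    (hp.integrable_signal _ le_rfl)] with k hk
  rw [← hk]
  exact timeFourier_deriv hp.absolutelyContinuous (hp.integrable_signal _ le_rfl)
    hp.integrable_derivS (tendsto_packet_cocompact f u x (h x)) k

theorem IsCausalPacket.derivS_eq_zero (hp : IsCausalPacket f u h x) {s : ℝ} (hs : s < 0) :
    packetDerivS f u h x s = 0 := by
  have : (fun s' => packet f u x (h x) s') =ᶠ[𝓝 s] fun _ => 0 := by
    filter_upwards [Iio_mem_nhds hs] with s' hs'
    exact hp.causal _ le_rfl s' hs'
  rw [packetDerivS, this.deriv_eq, deriv_const]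

/-- The transform commutes with the `z`-derivative at the boundary. Inversion holds off a null set
of wave numbers that depends on `z`, so the difference quotients are taken along a sequence of
heights, for which the union of these sets is still null; dominated convergence does the rest. -/
theorem IsCausalPacket.derivZ (hp : IsCausalPacket f u h x) :
    Integrable (packetDerivZ f u h x) ∧ ∀ᵐ k : ℝ, timeFourier (packetDerivZ f u h x) k =
      f k * derivWithin (fun z => u x z k) (Ici (h x)) (h x) := by
  obtain ⟨G, hG, hdom⟩ := hp.dominated
  obtain ⟨z, hz0, hzmem⟩ : ∃ z : ℕ → ℝ, Tendsto z atTop (𝓝[>] (h x)) ∧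
      ∀ n, h x < z n ∧ ∀ᵐ s : ℝ,
        ‖packet f u x (z n) s - packet f u x (h x) s‖ ≤ (z n - h x) * G s := by
    obtain ⟨z, hz⟩ := exists_seq_tendsto (𝓝[>] (h x))
    obtain ⟨N, hN⟩ := eventually_atTop.1 (hz.eventually (hdom.and self_mem_nhdsWithin))
    exact ⟨fun n => z (n + N), hz.comp (tendsto_add_atTop_nat N),
      fun n => ⟨(hN (n + N) (by omega)).2, (hN (n + N) (by omega)).1⟩⟩
  let D : ℕ → ℝ → ℂ := fun n s =>
    ((z n - h x : ℝ) : ℂ)⁻¹ * (packet f u x (z n) s - packet f u x (h x) s)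
  have quot : ∀ w : ℝ → ℂ, DifferentiableWithinAt ℝ w (Ici (h x)) (h x) →
      Tendsto (fun n => ((z n - h x : ℝ) : ℂ)⁻¹ * (w (z n) - w (h x))) atTop
        (𝓝 (derivWithin w (Ici (h x)) (h x))) := fun w hw => by
    have hd := (hw.hasDerivWithinAt).Ioi_of_Ici
    rw [hasDerivWithinAt_iff_tendsto_slope' (by simp)] at hd
    refine (hd.comp hz0).congr fun n => ?_
    simp [slope, Complex.real_smul]
  have hDint : ∀ n, Integrable (D n) := fun n =>
    ((hp.integrable_signal _ (hzmem n).1.le).sub (hp.integrable_signal _ le_rfl)).const_mul _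
  have hDle : ∀ n, ∀ᵐ s, ‖D n s‖ ≤ G s := fun n => by
    filter_upwards [(hzmem n).2] with s hs
    have hpos : 0 < z n - h x := sub_pos.2 (hzmem n).1
    simp only [D]
    rw [norm_mul, norm_inv, Complex.norm_real, Real.norm_of_nonneg hpos.le, inv_mul_le_iff₀ hpos]
    exact hs
  have hDlim : ∀ᵐ s, Tendsto (fun n => D n s) atTop (𝓝 (packetDerivZ f u h x s)) := by
    filter_upwards [hp.differentiable_packet] with s hs
    exact quot _ hs
  have hmeas : AEStronglyMeasurable (packetDerivZ f u h x) volume :=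
    aestronglyMeasurable_of_tendsto_ae atTop (fun n => (hDint n).aestronglyMeasurable) hDlim
  have hint : Integrable (packetDerivZ f u h x) := by
    refine hG.mono' hmeas ?_
    filter_upwards [hDlim, ae_all_iff.2 hDle] with s h1 h2
    exact le_of_tendsto h1.norm (Eventually.of_forall h2)
  refine ⟨hint, ?_⟩
  have hk0 := timeFourier_packet (hp.integrable_spectrum _ le_rfl) (hp.integrable_signal _ le_rfl)
  have hkn : ∀ᵐ k : ℝ, ∀ n, timeFourier (fun s => packet f u x (z n) s) k = f k * u x (z n) k :=
    ae_all_iff.2 fun n => timeFourier_packet (hp.integrable_spectrum _ (hzmem n).1.le)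
      (hp.integrable_signal _ (hzmem n).1.le)
  filter_upwards [hk0, hkn, hp.differentiable_amplitude] with k h0 hn hdiff
  have lim1 : Tendsto (fun n => timeFourier (D n) k) atTop
      (𝓝 (timeFourier (packetDerivZ f u h x) k)) := by
    refine tendsto_integral_of_dominated_convergence G
      (fun n => (integrable_phase_mul (hDint n) k).aestronglyMeasurable) hG (fun n => ?_) ?_
    · filter_upwards [hDle n] with s hs
      rwa [norm_mul, norm_phase, one_mul]
    · filter_upwards [hDlim] with s hs
      exact hs.const_mul _
  have hD : ∀ n, timeFourier (D n) k =
      f k * (((z n - h x : ℝ) : ℂ)⁻¹ * (u x (z n) k - u x (h x) k)) := fun n => by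
    simp only [D]
    rw [timeFourier_const_mul, timeFourier_sub (hp.integrable_signal _ (hzmem n).1.le)
      (hp.integrable_signal _ le_rfl), h0, hn]
    ring
  simp only [hD] at lim1
  by_cases hf : f k = 0
  · simp only [hf, zero_mul] at lim1 ⊢
    exact tendsto_nhds_unique lim1 tendsto_const_nhds
  · exact tendsto_nhds_unique lim1 ((quot _ (hdiff hf)).const_mul _)

/-! ### The Catalan generating function on the closed disc of radius `1/4` -/

/-- The partial sums telescope, since
`catalan m / 4 ^ m = 2 (c m / 4 ^ m - c (m + 1) / 4 ^ (m + 1))` for the central binomials `c`. -/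
theorem sum_range_catalan_div_four_pow (n : ℕ) :
    ∑ m ∈ Finset.range n, (catalan m : ℝ) / 4 ^ m = 2 * (1 - (n.centralBinom : ℝ) / 4 ^ n) := by
  induction n with
  | zero => simp
  | succ n ih =>
    have h1 : ((n : ℝ) + 1) * ((n + 1).centralBinom : ℝ) =
        2 * (2 * n + 1) * (n.centralBinom : ℝ) := by
      exact_mod_cast Nat.succ_mul_centralBinom_succ n
    have h2 : ((n : ℝ) + 1) * (catalan n : ℝ) = (n.centralBinom : ℝ) := by
      exact_mod_cast succ_mul_catalan_eq_centralBinom n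
    have hn : (n : ℝ) + 1 ≠ 0 := by positivity
    have h3 : ((n + 1).centralBinom : ℝ) = 2 * (2 * n + 1) * (catalan n : ℝ) := by
      apply mul_left_cancel₀ hn
      rw [h1, ← h2]
      ring
    rw [Finset.sum_range_succ, ih, h3, ← h2, pow_succ]
    field_simp
    ring

theorem summable_catalan_div_four_pow : Summable fun m : ℕ => (catalan m : ℝ) / 4 ^ m :=
  summable_of_sum_range_le (c := 2) (fun m => by positivity) fun n => by
    rw [sum_range_catalan_div_four_pow]
    have : (0 : ℝ) ≤ (n.centralBinom : ℝ) / 4 ^ n := by positivity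
    linarith

theorem tsum_catalan_div_four_pow_le : ∑' m : ℕ, (catalan m : ℝ) / 4 ^ m ≤ 2 :=
  Real.tsum_le_of_sum_range_le (fun m => by positivity) fun n => by
    rw [sum_range_catalan_div_four_pow]
    have : (0 : ℝ) ≤ (n.centralBinom : ℝ) / 4 ^ n := by positivity
    linarith

/-- The generating function `∑ catalan m * y ^ m`. -/
noncomputable def catalanSeries (y : ℂ) : ℂ := ∑' m : ℕ, (catalan m : ℂ) * y ^ m

theorem norm_catalan_term_le {y : ℂ} (hy : ‖y‖ ≤ 1 / 4) (m : ℕ) :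
    ‖(catalan m : ℂ) * y ^ m‖ ≤ (catalan m : ℝ) / 4 ^ m := by
  rw [norm_mul, norm_pow, Complex.norm_natCast, div_eq_mul_inv, ← inv_pow]
  gcongr
  linarith

theorem summable_norm_catalan_term {y : ℂ} (hy : ‖y‖ ≤ 1 / 4) :
    Summable fun m : ℕ => ‖(catalan m : ℂ) * y ^ m‖ :=
  .of_nonneg_of_le (fun _ => norm_nonneg _) (norm_catalan_term_le hy) summable_catalan_div_four_pow

theorem norm_catalanSeries_le {y : ℂ} (hy : ‖y‖ ≤ 1 / 4) : ‖catalanSeries y‖ ≤ 2 :=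
  (tsum_of_norm_bounded summable_catalan_div_four_pow.hasSum (norm_catalan_term_le hy)).trans
    tsum_catalan_div_four_pow_le

theorem catalanSeries_eq {y : ℂ} (hy : ‖y‖ ≤ 1 / 4) :
    catalanSeries y = 1 + y * catalanSeries y ^ 2 := by
  have hs := summable_norm_catalan_term hy
  have hmul : catalanSeries y ^ 2 = ∑' n : ℕ, (catalan (n + 1) : ℂ) * y ^ n := by
    rw [sq, catalanSeries, tsum_mul_tsum_eq_tsum_sum_antidiagonal_of_summable_norm hs hs]
    congr 1 with n
    rw [catalan_succ']
    push_cast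
    rw [Finset.sum_mul]
    refine Finset.sum_congr rfl fun ij hij => ?_
    rw [← Finset.HasAntidiagonal.mem_antidiagonal.1 hij, pow_add]
    ring
  rw [hmul, catalanSeries, hs.of_norm.tsum_eq_zero_add, ← tsum_mul_left]
  simp only [catalan_zero, Nat.cast_one, pow_zero, mul_one, pow_succ]
  congr 2 with n
  ring

/-- Completing the square in the functional equation of the generating function gives a square
root of `P² - q²`. -/
theorem sub_catalanSeries_sq {q P : ℂ} (hP : P ≠ 0) (hy : ‖(q / (2 * P)) ^ 2‖ ≤ 1 / 4) :
    (P - q ^ 2 / (2 * P) * catalanSeries ((q / (2 * P)) ^ 2)) ^ 2 = P ^ 2 - q ^ 2 := by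
  have h := catalanSeries_eq hy
  generalize catalanSeries ((q / (2 * P)) ^ 2) = C at h ⊢
  have h4 : 4 * P ^ 2 * C = 4 * P ^ 2 + q ^ 2 * C ^ 2 := by
    field_simp at h
    linear_combination h
  field_simp
  linear_combination (-q ^ 2) * h4

/-! ### Moments of the exponential -/

theorem integrableOn_pow_mul_cexp {P : ℂ} (hP : 0 < P.re) (n : ℕ) :
    IntegrableOn (fun t : ℝ => (t : ℂ) ^ n * Complex.exp (-(P * t))) (Ioi 0) := by
  have h := integrableOn_rpow_mul_exp_neg_mul_rpow (s := n) (p := 1)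
    (by have := n.cast_nonneg (α := ℝ); linarith) one_pos hP
  refine Integrable.mono' h (by fun_prop) ?_
  filter_upwards [ae_restrict_mem measurableSet_Ioi] with t ht
  have ht' : (0 : ℝ) < t := ht
  rw [norm_mul, norm_pow, Complex.norm_real, Real.norm_of_nonneg ht'.le, Complex.norm_exp,
    Real.rpow_natCast, Real.rpow_one]
  simp

theorem integral_pow_mul_cexp {P : ℂ} (hP : 0 < P.re) (n : ℕ) :
    ∫ t : ℝ in Ioi 0, (t : ℂ) ^ n * Complex.exp (-(P * t)) = n.factorial / P ^ (n + 1) := by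
  have hP0 : P ≠ 0 := fun h => by simp [h] at hP
  have hE : ∀ t : ℝ, HasDerivAt (fun s : ℝ => Complex.exp (-(P * s)))
      (-P * Complex.exp (-(P * t))) t := fun t => by
    have := ((hasDerivAt_id t).ofReal_comp.const_mul P).neg.cexp
    simpa [mul_comm] using this
  induction n with
  | zero =>
    have h := integral_exp_mul_complex_Ioi (a := -P) (by simpa using hP) 0
    simpa using h
  | succ n ih =>
    let F : ℝ → ℂ := fun t => (t : ℂ) ^ (n + 1) * Complex.exp (-(P * t))
    let F' : ℝ → ℂ := fun t => (n + 1 : ℂ) * ((t : ℂ) ^ n * Complex.exp (-(P * t))) - P * F t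
    have hF : ∀ t, HasDerivAt F (F' t) t := fun t => by
      have h1 : HasDerivAt (fun s : ℝ => (s : ℂ) ^ (n + 1)) ((n + 1 : ℂ) * (t : ℂ) ^ n) t := by
        have := (hasDerivAt_id t).ofReal_comp.pow (n + 1)
        simpa using! this
      refine (h1.fun_mul (hE t)).congr_deriv ?_
      simp only [F', F]
      ring
    have hi := (integrableOn_pow_mul_cexp hP n).const_mul (n + 1 : ℂ)
    have hi' := (integrableOn_pow_mul_cexp hP (n + 1)).const_mul P
    have hF'i : IntegrableOn F' (Ioi 0) := hi.sub hi'
    have hlim := tendsto_zero_of_hasDerivAt_of_integrableOn_Ioi (fun t _ => hF t) hF'i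
      (integrableOn_pow_mul_cexp hP (n + 1))
    have hI := integral_Ioi_of_hasDerivAt_of_tendsto' (fun t _ => hF t) hF'i hlim
    have hsplit : ∫ t in Ioi 0, F' t = (n + 1 : ℂ) * (n.factorial / P ^ (n + 1)) -
        P * ∫ t in Ioi 0, F t := by
      rw [← ih, ← integral_const_mul, ← integral_const_mul]
      exact integral_sub hi hi'
    rw [hsplit] at hI
    have hF0 : F 0 = 0 := by simp [F]
    rw [hF0, sub_zero, sub_eq_zero] at hI
    change ∫ t in Ioi 0, F t = _
    rw [Nat.factorial_succ]
    push_cast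
    apply mul_left_cancel₀ hP0
    rw [← hI]
    field_simp
    ring

/-! ### The memory density `q exp(-q t) I₁(q t) / t` -/

/-- The entire function `I₁(t) / t = ∑ (t/2)^(2m) / (2 m! (m+1)!)`. -/
noncomputable def besselRatio (t : ℝ) : ℝ :=
  ∑' m : ℕ, (t / 2) ^ (2 * m) / (2 * ((m.factorial : ℝ) * ((m + 1).factorial : ℝ)))

theorem besselRatio_term_nonneg (t : ℝ) (m : ℕ) :
    0 ≤ (t / 2) ^ (2 * m) / (2 * ((m.factorial : ℝ) * ((m + 1).factorial : ℝ))) := by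
  rw [pow_mul]
  positivity

theorem besselRatio_term_le {t R : ℝ} (ht : |t| ≤ R) (m : ℕ) :
    (t / 2) ^ (2 * m) / (2 * ((m.factorial : ℝ) * ((m + 1).factorial : ℝ))) ≤
      (R ^ 2) ^ m / (m.factorial : ℝ) := by
  have hm : (0 : ℝ) < (m.factorial : ℝ) := by exact_mod_cast m.factorial_pos
  have hm1 : (1 : ℝ) ≤ ((m + 1).factorial : ℝ) := by exact_mod_cast (m + 1).factorial_pos
  have h1 : (t / 2) ^ 2 ≤ R ^ 2 := by
    have h2 : t ^ 2 ≤ R ^ 2 := sq_le_sq' (by linarith [neg_abs_le t]) (by linarith [le_abs_self t])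
    linarith [sq_nonneg t, (by ring : (t / 2) ^ 2 = t ^ 2 / 4)]
  rw [pow_mul]
  gcongr
  nlinarith

theorem continuous_besselRatio : Continuous besselRatio := by
  refine continuous_iff_continuousAt.2 fun t => ?_
  have hon : ContinuousOn besselRatio (Icc (-(|t| + 1)) (|t| + 1)) := by
    refine continuousOn_tsum (fun m => by fun_prop)
      (Real.summable_pow_div_factorial ((|t| + 1) ^ 2)) fun m s hs => ?_
    rw [Real.norm_of_nonneg (besselRatio_term_nonneg s m)]
    exact besselRatio_term_le (abs_le.2 hs) m
  exact hon.continuousAt (Icc_mem_nhds (by linarith [neg_abs_le t]) (by linarith [le_abs_self t]))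

theorem besselI1_eq (t : ℝ) : besselI1 t = t * besselRatio t := by
  rw [besselI1, besselRatio, ← tsum_mul_left]
  congr 1 with m
  rw [besselTerm, pow_succ]
  field_simp

/-- The density `q exp(-q t) I₁(q t) / t`, extended continuously to `t = 0`. -/
noncomputable def memoryDensity (q t : ℝ) : ℝ :=
  q ^ 2 * Real.exp (-(q * t)) * besselRatio (q * t)

/-- The coefficient of `t ^ (2 m)` in `exp(q t)` times the memory density. -/
noncomputable def densityCoeff (q : ℝ) (m : ℕ) : ℝ :=
  q ^ 2 * ((q / 2) ^ (2 * m) / (2 * ((m.factorial : ℝ) * ((m + 1).factorial : ℝ))))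

theorem densityCoeff_nonneg (q : ℝ) (m : ℕ) : 0 ≤ densityCoeff q m :=
  mul_nonneg (sq_nonneg q) (besselRatio_term_nonneg q m)

theorem memoryDensity_eq_tsum (q t : ℝ) :
    memoryDensity q t = ∑' m : ℕ, densityCoeff q m * (t ^ (2 * m) * Real.exp (-(q * t))) := by
  rw [memoryDensity, besselRatio, ← tsum_mul_left]
  congr 1 with m
  rw [densityCoeff, mul_div_right_comm q t 2, mul_pow]
  ring

theorem factorial_two_mul_eq (m : ℕ) :
    (2 * m).factorial = m.factorial * (m + 1).factorial * catalan m := by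
  have h := Nat.choose_mul_factorial_mul_factorial (show m ≤ 2 * m by omega)
  rw [show 2 * m - m = m by omega, ← Nat.centralBinom_eq_two_mul_choose,
    ← succ_mul_catalan_eq_centralBinom] at h
  rw [← h, Nat.factorial_succ]
  ring

theorem densityCoeff_mul_moment (q : ℝ) (m : ℕ) {P : ℂ} (hP : P ≠ 0) :
    (densityCoeff q m : ℂ) * ((2 * m).factorial / P ^ (2 * m + 1)) =
      (q : ℂ) ^ 2 / (2 * P) * ((catalan m : ℂ) * (((q : ℂ) / (2 * P)) ^ 2) ^ m) := by
  have h1 : (m.factorial : ℂ) ≠ 0 := by exact_mod_cast m.factorial_ne_zero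
  have h2 : ((m + 1).factorial : ℂ) ≠ 0 := by exact_mod_cast (m + 1).factorial_ne_zero
  rw [densityCoeff, factorial_two_mul_eq, ← pow_mul, pow_succ]
  push_cast
  rw [div_pow, div_pow, mul_pow]
  field_simp
  ring

theorem integral_densityTerm (q : ℝ) (m : ℕ) {P : ℂ} (hP : 0 < P.re) :
    ∫ t : ℝ in Ioi 0, (densityCoeff q m : ℂ) * ((t : ℂ) ^ (2 * m) * Complex.exp (-(P * t))) =
      (q : ℂ) ^ 2 / (2 * P) * ((catalan m : ℂ) * (((q : ℂ) / (2 * P)) ^ 2) ^ m) := by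
  have hP0 : P ≠ 0 := fun h => by simp [h] at hP
  rw [integral_const_mul, integral_pow_mul_cexp hP, densityCoeff_mul_moment q m hP0]

theorem integral_norm_densityTerm {q : ℝ} (hq : 0 < q) (m : ℕ) {P : ℂ} (hP : P.re = q) :
    ∫ t : ℝ in Ioi 0, ‖(densityCoeff q m : ℂ) * ((t : ℂ) ^ (2 * m) * Complex.exp (-(P * t)))‖ =
      q / 2 * ((catalan m : ℝ) / 4 ^ m) := by
  have key : ∀ t ∈ Ioi (0 : ℝ),
      ((‖(densityCoeff q m : ℂ) * ((t : ℂ) ^ (2 * m) * Complex.exp (-(P * t)))‖ : ℝ) : ℂ) =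
      (densityCoeff q m : ℂ) * ((t : ℂ) ^ (2 * m) * Complex.exp (-((q : ℂ) * t))) := by
    intro t ht
    have ht' : (0 : ℝ) < t := ht
    rw [norm_mul, norm_mul, norm_pow, Complex.norm_real, Complex.norm_real,
      Real.norm_of_nonneg ht'.le, Real.norm_of_nonneg (densityCoeff_nonneg q m), Complex.norm_exp]
    push_cast
    simp [hP]
  have hc : ((∫ t : ℝ in Ioi 0,
      ‖(densityCoeff q m : ℂ) * ((t : ℂ) ^ (2 * m) * Complex.exp (-(P * t)))‖ : ℝ) : ℂ) =
      ((q / 2 * ((catalan m : ℝ) / 4 ^ m) : ℝ) : ℂ) := by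
    rw [← integral_complex_ofReal, setIntegral_congr_fun measurableSet_Ioi key,
      integral_densityTerm q m (by simpa using hq)]
    have hq' : (q : ℂ) ≠ 0 := by exact_mod_cast hq.ne'
    rw [show (q : ℂ) / (2 * q) = 1 / 2 by field_simp, show (q : ℂ) ^ 2 / (2 * q) = q / 2 by
      field_simp]
    push_cast
    rw [show ((1 : ℂ) / 2) ^ 2 = 4⁻¹ by norm_num, inv_pow]
    rfl
  exact_mod_cast hc

/-- Termwise integration: on the line `re P = q` the sum of the `L¹` norms of the terms is the
convergent Catalan series at `1/4`. -/
theorem integral_exp_mul_memoryDensity {q : ℝ} (hq : 0 < q) {P : ℂ} (hP : P.re = q) :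
    ∫ t : ℝ in Ioi 0, Complex.exp (-((P - q) * t)) * (memoryDensity q t : ℂ) =
      (q : ℂ) ^ 2 / (2 * P) * catalanSeries (((q : ℂ) / (2 * P)) ^ 2) := by
  have hPre : 0 < P.re := hP ▸ hq
  have h := hasSum_integral_of_summable_integral_norm (μ := volume.restrict (Ioi (0 : ℝ)))
    (F := fun (m : ℕ) (t : ℝ) =>
      (densityCoeff q m : ℂ) * ((t : ℂ) ^ (2 * m) * Complex.exp (-(P * t))))
    (fun m => (integrableOn_pow_mul_cexp hPre (2 * m)).const_mul _)
    (by
      simp only [integral_norm_densityTerm hq _ hP]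
      exact summable_catalan_div_four_pow.mul_left _)
  simp only [integral_densityTerm q _ hPre] at h
  have h' := h.tsum_eq
  rw [tsum_mul_left] at h'
  rw [catalanSeries, h']
  refine integral_congr_ae (Eventually.of_forall fun t => ?_)
  simp only
  rw [memoryDensity_eq_tsum, Complex.ofReal_tsum, ← tsum_mul_left]
  congr 1 with m
  push_cast
  rw [mul_left_comm, mul_left_comm (Complex.exp _), ← Complex.exp_add]
  congr 4
  ring

/-- The density is integrable up to infinity because the rates `q` of the exponential and of the
growth of `I₁(q t)` cancel exactly and the Catalan series still converges at `1/4`. -/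
theorem integrableOn_memoryDensity {q : ℝ} (hq : 0 < q) :
    IntegrableOn (memoryDensity q) (Ioi 0) := by
  have h := hasSum_integral_of_summable_integral_norm (μ := volume.restrict (Ioi (0 : ℝ)))
    (F := fun (m : ℕ) (t : ℝ) =>
      ‖(densityCoeff q m : ℂ) * ((t : ℂ) ^ (2 * m) * Complex.exp (-((q : ℂ) * t)))‖)
    (fun m => ((integrableOn_pow_mul_cexp (by simpa using hq) (2 * m)).const_mul _).norm)
    (by
      simp only [norm_norm, integral_norm_densityTerm hq _ (Complex.ofReal_re q)]
      exact summable_catalan_div_four_pow.mul_left _)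
  simp only [integral_norm_densityTerm hq _ (Complex.ofReal_re q)] at h
  have hpos : 0 < ∑' m : ℕ, q / 2 * ((catalan m : ℝ) / 4 ^ m) :=
    h.summable.tsum_pos (fun m => by positivity) 0 (by simpa using hq)
  rw [h.tsum_eq] at hpos
  -- The integral is nonzero, which a non-integrable function would not allow.
  refine (Integrable.of_integral_ne_zero hpos.ne').congr ?_
  filter_upwards [ae_restrict_mem measurableSet_Ioi] with t ht
  rw [memoryDensity_eq_tsum]
  congr 1 with m
  have ht' : (0 : ℝ) < t := ht
  rw [norm_mul, norm_mul, norm_pow, Complex.norm_real, Complex.norm_real,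
    Real.norm_of_nonneg ht'.le, Real.norm_of_nonneg (densityCoeff_nonneg q m), Complex.norm_exp]
  simp

/-! ### Causal convolutions -/

/-- The restriction of a signal to positive instants. -/
noncomputable def causalPart (g : ℝ → ℂ) : ℝ → ℂ := (Ioi 0).indicator g

theorem timeFourier_causalPart (g : ℝ → ℂ) (k : ℝ) :
    timeFourier (causalPart g) k =
      ∫ s : ℝ in Ioi 0, Complex.exp (Complex.I * (k : ℂ) * (s : ℂ)) * g s := by
  rw [timeFourier, ← integral_indicator measurableSet_Ioi]
  congr 1 with s
  simp only [causalPart, indicator]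
  split_ifs <;> simp

/-- Convolving a causal signal with the causal part of a kernel gives the memory integral. Both
sides vanish for `s < 0`, where the interval of integration is reversed. -/
theorem convolution_causalPart {f : ℝ → ℂ} (hf : ∀ t < 0, f t = 0) (g : ℝ → ℂ) (s : ℝ) :
    (f ⋆[ContinuousLinearMap.mul ℂ ℂ] causalPart g) s =
      ∫ t in (0 : ℝ)..s, f t * g (s - t) := by
  have hne : ∀ a : ℝ, ∀ᵐ t : ℝ, t ≠ a := fun a => by
    simp [ae_iff, measure_singleton]
  simp only [convolution, ContinuousLinearMap.mul_apply']
  rcases le_or_gt 0 s with hs | hs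
  · rw [intervalIntegral.integral_of_le hs, ← integral_indicator measurableSet_Ioc]
    refine integral_congr_ae ?_
    filter_upwards [hne 0, hne s] with t h0 h1
    simp only [causalPart, indicator, mem_Ioi, mem_Ioc]
    rcases lt_or_gt_of_ne h0 with ht | ht
    · simp [hf t ht]
    · rcases lt_or_gt_of_ne h1 with hts | hts
      · simp [ht, hts.le, hts]
      · simp [hts.not_ge, hts.le]
  · have h1 : ∀ᵐ t : ℝ, f t * causalPart g (s - t) = 0 := Eventually.of_forall fun t => by
      rcases lt_or_ge t 0 with ht | ht
      · simp [hf t ht]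
      · simp [causalPart, (by linarith : s ≤ t)]
    rw [integral_congr_ae h1, integral_zero, intervalIntegral.integral_symm,
      intervalIntegral.integral_of_le hs.le]
    have h2 : ∫ t in Ioc s 0, f t * g (s - t) = ∫ t in Ioc s 0, (0 : ℂ) := by
      refine setIntegral_congr_ae measurableSet_Ioc ?_
      filter_upwards [hne 0] with t h0 ht
      rw [hf t (lt_of_le_of_ne ht.2 h0), zero_mul]
    rw [h2, integral_zero, neg_zero]

/-! ### The memory kernel and its transform -/

theorem kernelIntegrand_eq (c ε σ : ℝ) {t : ℝ} (ht : t ≠ 0) :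
    kernelIntegrand c ε σ t = Real.exp ((rParam c ε σ - qParam c ε σ) * t) *
      (qParam c ε σ * besselRatio (qParam c ε σ * t)) := by
  rw [kernelIntegrand, besselI1_eq]
  field_simp

theorem ae_kernelIntegrand_eq (c ε σ : ℝ) : kernelIntegrand c ε σ =ᵐ[volume] fun t =>
    Real.exp ((rParam c ε σ - qParam c ε σ) * t) *
      (qParam c ε σ * besselRatio (qParam c ε σ * t)) := by
  have h0 : ∀ᵐ t : ℝ, t ≠ 0 := by simp [ae_iff, measure_singleton]
  filter_upwards [h0] with t ht using kernelIntegrand_eq c ε σ ht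

theorem intervalIntegrable_kernelIntegrand (c ε σ a b : ℝ) :
    IntervalIntegrable (kernelIntegrand c ε σ) volume a b := by
  have hc : Continuous fun t => Real.exp ((rParam c ε σ - qParam c ε σ) * t) *
      (qParam c ε σ * besselRatio (qParam c ε σ * t)) := by
    have := continuous_besselRatio
    fun_prop
  exact (hc.intervalIntegrable a b).congr_ae (ae_restrict_of_ae (ae_kernelIntegrand_eq c ε σ).symm)

theorem continuous_memoryKernel (c ε σ : ℝ) : Continuous (memoryKernel c ε σ) := by
  have h := intervalIntegral.continuous_primitive
    (fun a b => intervalIntegrable_kernelIntegrand c ε σ a b) 0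
  unfold memoryKernel
  fun_prop

theorem memoryKernel_eq (c ε σ s : ℝ) : memoryKernel c ε σ s =
    (∫ t in (0 : ℝ)..s, memoryDensity (qParam c ε σ) t * Real.exp (-(rParam c ε σ * (s - t)))) +
      (rParam c ε σ - qParam c ε σ) * Real.exp (-(rParam c ε σ * s)) := by
  set r := rParam c ε σ
  set q := qParam c ε σ
  have h : ∫ t in (0 : ℝ)..s, memoryDensity q t * Real.exp (-(r * (s - t))) =
      Real.exp (-(r * s)) * (q * ∫ t in (0 : ℝ)..s, kernelIntegrand c ε σ t) := by
    rw [← intervalIntegral.integral_const_mul, ← intervalIntegral.integral_const_mul]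
    refine intervalIntegral.integral_congr_ae ?_
    filter_upwards [ae_kernelIntegrand_eq c ε σ] with t ht _
    rw [ht, memoryDensity, show -(r * (s - t)) = -(r * s) + r * t by ring,
      show (r - q) * t = r * t + -(q * t) by ring, Real.exp_add, Real.exp_add]
    ring
  rw [h, memoryKernel]
  ring

/-- The causal exponential `exp(-r s)`, `s > 0`. -/
noncomputable def causalExp (r : ℝ) : ℝ → ℂ := causalPart fun s => (Real.exp (-(r * s)) : ℂ)

/-- The memory density on `t > 0`. -/
noncomputable def causalDensity (q : ℝ) : ℝ → ℂ := causalPart fun t => (memoryDensity q t : ℂ)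

/-- The memory kernel on `s > 0`. -/
noncomputable def causalKernel (c ε σ : ℝ) : ℝ → ℂ :=
  causalPart fun s => (memoryKernel c ε σ s : ℂ)

theorem integrable_causalExp {r : ℝ} (hr : 0 < r) : Integrable (causalExp r) := by
  refine (integrable_indicator_iff measurableSet_Ioi).2 ?_
  have := (exp_neg_integrableOn_Ioi 0 hr).ofReal (𝕜 := ℂ)
  simpa [neg_mul] using! this

theorem integrable_causalDensity {q : ℝ} (hq : 0 < q) : Integrable (causalDensity q) :=
  (integrable_indicator_iff measurableSet_Ioi).2 (integrableOn_memoryDensity hq).ofReal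

theorem timeFourier_causalExp {r : ℝ} (hr : 0 < r) (k : ℝ) :
    timeFourier (causalExp r) k = 1 / (r - Complex.I * k) := by
  have h := integral_exp_mul_complex_Ioi (a := -(r - Complex.I * k)) (by simpa using hr) 0
  rw [causalExp, timeFourier_causalPart]
  simp only [Complex.ofReal_zero, mul_zero, Complex.exp_zero, neg_div_neg_eq] at h
  rw [← h]
  congr 1 with s
  rw [Complex.ofReal_exp, ← Complex.exp_add]
  congr 1
  push_cast
  ring

/-- The transform `T` of the memory density is `P` minus a square root of `P² - q²`, where
`P = q - i k` and so `P² - q² = -k (k + 2 i q)`. Both `P - T` and `-i` times the dispersive root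
lie in the closed right half-plane, the latter in its interior, so they agree. -/
theorem timeFourier_causalDensity {q : ℝ} (hq : 0 < q) {k : ℝ} (hk : k ≠ 0) :
    timeFourier (causalDensity q) k = q - Complex.I * k + Complex.I * dispersiveRoot q k := by
  set P : ℂ := q - Complex.I * k with hPdef
  have hPre : P.re = q := by simp [hPdef]
  have hP0 : P ≠ 0 := fun h => by rw [h] at hPre; simp at hPre; exact hq.ne hPre
  have hqP : q ≤ ‖P‖ := hPre ▸ Complex.re_le_norm P
  have hPpos : 0 < ‖P‖ := hq.trans_le hqP
  set y : ℂ := ((q : ℂ) / (2 * P)) ^ 2 with hy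
  have hyle : ‖y‖ ≤ 1 / 4 := by
    have h1 : ‖(q : ℂ) / (2 * P)‖ ≤ 1 / 2 := by
      rw [norm_div, norm_mul, Complex.norm_real, Real.norm_of_nonneg hq.le, Complex.norm_two,
        div_le_iff₀ (by positivity)]
      linarith
    rw [hy, norm_pow]
    nlinarith [norm_nonneg ((q : ℂ) / (2 * P))]
  have hT : timeFourier (causalDensity q) k = (q : ℂ) ^ 2 / (2 * P) * catalanSeries y := by
    rw [hy, ← integral_exp_mul_memoryDensity hq hPre, causalDensity, timeFourier_causalPart]
    congr 1 with t
    congr 2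
    rw [hPdef]
    ring
  rw [hT]
  set T : ℂ := (q : ℂ) ^ 2 / (2 * P) * catalanSeries y with hTdef
  have hTle : ‖T‖ ≤ q := by
    rw [hTdef, norm_mul, norm_div, norm_mul, norm_pow, Complex.norm_real,
      Real.norm_of_nonneg hq.le, Complex.norm_two]
    calc q ^ 2 / (2 * ‖P‖) * ‖catalanSeries y‖ ≤ q ^ 2 / (2 * q) * 2 := by
          gcongr
          exact norm_catalanSeries_le hyle
      _ = q := by field_simp
  have hre : 0 ≤ (P - T).re := by
    rw [Complex.sub_re, hPre]
    linarith [Complex.re_le_norm T]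
  have hsq : (P - T) ^ 2 = (-(Complex.I * dispersiveRoot q k)) ^ 2 := by
    rw [hTdef, sub_catalanSeries_sq hP0 hyle, neg_sq, mul_pow, Complex.I_sq,
      dispersiveRoot_sq q k hk, hPdef]
    linear_combination (k : ℂ) ^ 2 * Complex.I_sq
  -- The imaginary part of the principal root has the sign of `2 q / k`.
  have hroot : 0 < (-(Complex.I * dispersiveRoot q k)).re := by
    have e1 : (1 + 2 * Complex.I * (q : ℂ) / (k : ℂ)) = ⟨1, 2 * q / k⟩ := by
      rw [show 2 * Complex.I * (q : ℂ) / (k : ℂ) =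
        ((2 * q / k : ℝ) : ℂ) * Complex.I by push_cast; ring]
      apply Complex.ext <;> simp
    set w : ℂ := (1 + 2 * Complex.I * (q : ℂ) / (k : ℂ)) ^ (1 / 2 : ℂ) with hw
    have hww : w ^ 2 = ⟨1, 2 * q / k⟩ := by
      rw [hw, ← Complex.cpow_nat_mul, e1]
      norm_num
    have hwre : 0 ≤ w.re := by
      rw [hw, one_div, Complex.cpow_inv_two_re]
      positivity
    have him : 2 * (w.re * w.im) = 2 * q / k := by
      have := congrArg Complex.im hww
      simp only [sq, Complex.mul_im] at this
      linarith
    have hval : (-(Complex.I * dispersiveRoot q k)).re = k * w.im := by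
      rw [dispersiveRoot, ← hw]
      simp
    rw [hval]
    have hprod : w.re * (k * w.im) = q := by
      field_simp at him
      linarith
    by_contra hneg
    have := mul_nonpos_of_nonneg_of_nonpos hwre (not_lt.1 hneg)
    linarith
  rcases sq_eq_sq_iff_eq_or_eq_neg.1 hsq with h | h
  · linear_combination -h
  · rw [h, Complex.neg_re] at hre
    linarith

theorem qParam_pos {c ε σ : ℝ} (hc : 0 < c) (hε : 1 < ε) (hσ : 0 < σ) : 0 < qParam c ε σ := by
  have : 0 < ε - 1 := by linarith
  unfold qParam
  positivity

theorem rParam_pos {c ε σ : ℝ} (hc : 0 < c) (hε : 1 < ε) (hσ : 0 < σ) : 0 < rParam c ε σ := by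
  have : 0 < ε := by linarith
  unfold rParam
  positivity

/-- Without conductivity there is no memory. -/
theorem causalKernel_zero (c ε : ℝ) : causalKernel c ε 0 = 0 := by
  ext s
  simp [causalKernel, causalPart, memoryKernel, rParam, qParam]

/-- The kernel is the convolution of the memory density with a decaying exponential, plus a
multiple of that exponential. -/
theorem causalKernel_eq (c ε σ s : ℝ) : causalKernel c ε σ s =
    (causalDensity (qParam c ε σ) ⋆[ContinuousLinearMap.mul ℂ ℂ] causalExp (rParam c ε σ)) s +
      ((rParam c ε σ - qParam c ε σ : ℝ) : ℂ) * causalExp (rParam c ε σ) s := by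
  have h0 : ∀ t < 0, causalDensity (qParam c ε σ) t = 0 := fun t ht => by
    simp [causalDensity, causalPart, ht.le]
  rw [causalExp, convolution_causalPart h0]
  rcases le_or_gt s 0 with hs | hs
  · have h1 : ∫ t in (0 : ℝ)..s, causalDensity (qParam c ε σ) t *
        (Real.exp (-(rParam c ε σ * (s - t))) : ℂ) = 0 := by
      rw [intervalIntegral.integral_symm, intervalIntegral.integral_of_le hs,
        setIntegral_eq_zero_of_forall_eq_zero, neg_zero]
      intro t ht
      simp [causalDensity, causalPart, ht.2]
    rw [h1]
    simp [causalKernel, causalPart, hs]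
  · simp only [causalKernel, causalPart, indicator_of_mem (show s ∈ Ioi (0 : ℝ) from hs)]
    rw [memoryKernel_eq]
    push_cast
    rw [← intervalIntegral.integral_ofReal]
    congr 1
    rw [intervalIntegral.integral_of_le hs.le, intervalIntegral.integral_of_le hs.le]
    refine setIntegral_congr_fun measurableSet_Ioc fun t ht => ?_
    simp only [causalDensity, causalPart, indicator_of_mem (show t ∈ Ioi (0 : ℝ) from ht.1)]
    push_cast
    rfl

theorem integrable_causalKernel {c ε σ : ℝ} (hc : 0 < c) (hε : 1 < ε) (hσ : 0 ≤ σ) :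
    Integrable (causalKernel c ε σ) := by
  rcases hσ.eq_or_lt with rfl | hσ
  · rw [causalKernel_zero]
    exact integrable_zero _ _ _
  · have hE := integrable_causalExp (rParam_pos hc hε hσ)
    rw [funext (causalKernel_eq c ε σ)]
    exact ((integrable_causalDensity (qParam_pos hc hε hσ)).integrable_convolution _ hE).add
      (hE.const_mul _)

theorem norm_causalExp_le {r : ℝ} (hr : 0 < r) (s : ℝ) : ‖causalExp r s‖ ≤ 1 := by
  rw [causalExp, causalPart, indicator]
  split_ifs with hs
  · rw [Complex.norm_real, Real.norm_of_nonneg (Real.exp_nonneg _), Real.exp_le_one_iff]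
    have : 0 < r * s := mul_pos hr hs
    linarith
  · simp

theorem exists_norm_causalKernel_le {c ε σ : ℝ} (hc : 0 < c) (hε : 1 < ε) (hσ : 0 ≤ σ) :
    ∃ B, ∀ s, ‖causalKernel c ε σ s‖ ≤ B := by
  rcases hσ.eq_or_lt with rfl | hσ
  · exact ⟨0, fun s => by simp [causalKernel_zero]⟩
  · have hD := integrable_causalDensity (qParam_pos hc hε hσ)
    have hE := norm_causalExp_le (rParam_pos hc hε hσ)
    refine ⟨(∫ t, ‖causalDensity (qParam c ε σ) t‖) + |rParam c ε σ - qParam c ε σ|, fun s => ?_⟩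
    rw [causalKernel_eq]
    refine (norm_add_le _ _).trans (add_le_add ?_ ?_)
    · refine norm_integral_le_of_norm_le hD.norm (Eventually.of_forall fun t => ?_)
      rw [ContinuousLinearMap.mul_apply', norm_mul]
      exact mul_le_of_le_one_right (norm_nonneg _) (hE _)
    · rw [norm_mul, Complex.norm_real, Real.norm_eq_abs]
      exact mul_le_of_le_one_right (abs_nonneg _) (hE _)

/-- The surface factor is, up to the constant `√(ε-1)/ε`, one minus the transform of the memory
kernel. -/
theorem surfaceFactor_eq_timeFourier {c ε σ : ℝ} (hc : 0 < c) (hε : 1 < ε) (hσ : 0 ≤ σ) {k : ℝ}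
    (hk : k ≠ 0) : surfaceFactor c ε σ k =
      ((Real.sqrt (ε - 1) / ε : ℝ) : ℂ) * (1 - timeFourier (causalKernel c ε σ) k) := by
  have hk' : (k : ℂ) ≠ 0 := by exact_mod_cast hk
  rw [surfaceFactor]
  congr 1
  rcases hσ.eq_or_lt with rfl | hσ
  · rw [causalKernel_zero]
    simp [timeFourier, dispersiveRoot, qParam, rParam, hk']
  · have hr := rParam_pos hc hε hσ
    have hD := integrable_causalDensity (qParam_pos hc hε hσ)
    have hE := integrable_causalExp hr
    have hr0 : (rParam c ε σ : ℂ) - Complex.I * k ≠ 0 := fun h => by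
      have := congrArg Complex.re h
      simp at this
      exact hr.ne' this
    have hr1 : (k : ℂ) + Complex.I * (rParam c ε σ : ℂ) =
        Complex.I * ((rParam c ε σ : ℂ) - Complex.I * k) := by
      linear_combination (k : ℂ) * Complex.I_sq
    rw [funext (causalKernel_eq c ε σ),
      timeFourier_add (hD.integrable_convolution _ hE) (hE.const_mul _), timeFourier_const_mul,
      timeFourier_convolution hD hE, timeFourier_causalExp hr,
      timeFourier_causalDensity (qParam_pos hc hε hσ) hk, hr1]
    push_cast
    field_simp
    linear_combination dispersiveRoot (qParam c ε σ) k * Complex.I_sq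

/-! ### Equivalence of the boundary conditions -/

variable {c ε σ : ℝ}

/-- The defect of the time-domain condition, with the memory integral written as a convolution. -/
noncomputable def timeDomainDefect (c ε σ : ℝ) (h : ℝ → ℝ) (f : ℝ → ℂ) (u : ℝ → ℝ → ℝ → ℂ)
    (x s : ℝ) : ℂ :=
  (packetDerivZ f u h x s + ((deriv h x : ℝ) : ℂ) * packetDerivS f u h x s) -
    ((Real.sqrt (ε - 1) / ε : ℝ) : ℂ) * (packetDerivS f u h x s -
      (packetDerivS f u h x ⋆[ContinuousLinearMap.mul ℂ ℂ] causalKernel c ε σ) s)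

theorem IsCausalPacket.timeDomainCondition_iff (hp : IsCausalPacket f u h x) (s : ℝ) :
    TimeDomainCondition c ε σ h f u x s ↔ timeDomainDefect c ε σ h f u x s = 0 := by
  rw [timeDomainDefect, causalKernel, convolution_causalPart (fun t => hp.derivS_eq_zero),
    sub_eq_zero, TimeDomainCondition]

theorem IsCausalPacket.integrable_timeDomainDefect (hp : IsCausalPacket f u h x) (hc : 0 < c)
    (hε : 1 < ε) (hσ : 0 ≤ σ) : Integrable (timeDomainDefect c ε σ h f u x) :=
  (hp.derivZ.1.add (hp.integrable_derivS.const_mul _)).sub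
    ((hp.integrable_derivS.sub (hp.integrable_derivS.integrable_convolution _
      (integrable_causalKernel hc hε hσ))).const_mul _)

/-- The transform of the time-domain defect is the weighted defect of the impedance condition. -/
theorem IsCausalPacket.timeFourier_timeDomainDefect (hp : IsCausalPacket f u h x) (hc : 0 < c)
    (hε : 1 < ε) (hσ : 0 ≤ σ) :
    ∀ᵐ k : ℝ, timeFourier (timeDomainDefect c ε σ h f u x) k =
      f k * (derivWithin (fun z => u x z k) (Ici (h x)) (h x) +
        Complex.I * (k : ℂ) * (surfaceFactor c ε σ k - ((deriv h x : ℝ) : ℂ)) * u x (h x) k) := by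
  have hS : Integrable (packetDerivS f u h x) := hp.integrable_derivS
  have hN := integrable_causalKernel hc hε hσ
  have hconv := hS.integrable_convolution (ContinuousLinearMap.mul ℂ ℂ) hN
  have hsum : Integrable fun s =>
      packetDerivZ f u h x s + ((deriv h x : ℝ) : ℂ) * packetDerivS f u h x s :=
    hp.derivZ.1.add (hS.const_mul _)
  have hdiff : Integrable fun s => packetDerivS f u h x s -
      (packetDerivS f u h x ⋆[ContinuousLinearMap.mul ℂ ℂ] causalKernel c ε σ) s :=
    hS.sub hconv
  have h0 : ∀ᵐ k : ℝ, k ≠ 0 := by simp [ae_iff, measure_singleton]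
  filter_upwards [hp.derivZ.2, hp.timeFourier_derivS, h0] with k hZk hSk hk
  have e : timeDomainDefect c ε σ h f u x = fun s =>
      (packetDerivZ f u h x s + ((deriv h x : ℝ) : ℂ) * packetDerivS f u h x s) -
      ((Real.sqrt (ε - 1) / ε : ℝ) : ℂ) * (packetDerivS f u h x s -
        (packetDerivS f u h x ⋆[ContinuousLinearMap.mul ℂ ℂ] causalKernel c ε σ) s) := rfl
  rw [e, timeFourier_sub hsum (hdiff.const_mul _),
    timeFourier_add hp.derivZ.1 (hS.const_mul _), timeFourier_const_mul, timeFourier_const_mul,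
    timeFourier_sub hS hconv, timeFourier_convolution hS hN, hZk, hSk,
    surfaceFactor_eq_timeFourier hc hε hσ hk]
  ring

theorem IsCausalPacket.impedance_iff_timeDomain (hp : IsCausalPacket f u h x) (hc : 0 < c)
    (hε : 1 < ε) (hσ : 0 ≤ σ) :
    (∀ᵐ k : ℝ, f k ≠ 0 → ImpedanceCondition c ε σ h u x k) ↔
      ∀ᵐ s : ℝ, TimeDomainCondition c ε σ h f u x s := by
  have hint := hp.integrable_timeDomainDefect hc hε hσ
  have hF := hp.timeFourier_timeDomainDefect hc hε hσ
  constructor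
  · intro hA
    have h1 : timeFourier (timeDomainDefect c ε σ h f u x) =ᵐ[volume] fun _ => 0 := by
      filter_upwards [hF, hA] with k hFk hAk
      rw [hFk]
      by_cases hfk : f k = 0
      · rw [hfk, zero_mul]
      · rw [show _ + _ = _ from hAk hfk, mul_zero]
    have h2 := (continuous_timeFourier hint).ae_eq_iff_eq volume continuous_const |>.1 h1
    filter_upwards [ae_eq_zero_of_timeFourier_eq_zero hint (congrFun h2)] with s hs
    exact (hp.timeDomainCondition_iff s).2 hs
  · intro hB
    have h1 : timeDomainDefect c ε σ h f u x =ᵐ[volume] fun _ => 0 := by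
      filter_upwards [hB] with s hs using (hp.timeDomainCondition_iff s).1 hs
    filter_upwards [hF] with k hFk hfk
    rw [timeFourier_congr_ae h1, show timeFourier (fun _ => 0) k = 0 by simp [timeFourier]] at hFk
    exact (mul_eq_zero.1 hFk.symm).resolve_left hfk

/-- The memory integral is continuous: the kernel is bounded, and its only jump is at `0`. -/
theorem continuous_convolution_causalKernel (hc : 0 < c) (hε : 1 < ε) (hσ : 0 ≤ σ) {g : ℝ → ℂ}
    (hg : Integrable g) :
    Continuous (g ⋆[ContinuousLinearMap.mul ℂ ℂ] causalKernel c ε σ) := by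
  obtain ⟨B, hB⟩ := exists_norm_causalKernel_le hc hε hσ
  have hmeas : Measurable (causalKernel c ε σ) :=
    (Complex.continuous_ofReal.comp (continuous_memoryKernel c ε σ)).measurable.indicator
      measurableSet_Ioi
  have hcont : ∀ t : ℝ, t ≠ 0 → ContinuousAt (causalKernel c ε σ) t := fun t ht => by
    rcases lt_or_gt_of_ne ht with ht | ht
    · refine (continuousAt_const (y := (0 : ℂ))).congr ?_
      filter_upwards [Iio_mem_nhds ht] with t' ht'
      simp [causalKernel, causalPart, (mem_Iio.1 ht').le]
    · refine (Complex.continuous_ofReal.comp (continuous_memoryKernel c ε σ)).continuousAt.congr ?_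
      filter_upwards [Ioi_mem_nhds ht] with t' ht'
      simp [causalKernel, causalPart, mem_Ioi.1 ht']
  refine continuous_iff_continuousAt.2 fun s => ?_
  refine continuousAt_of_dominated (bound := fun t => ‖g t‖ * B)
    (Eventually.of_forall fun s' => ?_) (Eventually.of_forall fun s' => ?_) (hg.norm.mul_const B) ?_
  · simp only [ContinuousLinearMap.mul_apply']
    exact hg.aestronglyMeasurable.mul
      (hmeas.comp (measurable_const.sub measurable_id)).aestronglyMeasurable
  · refine Eventually.of_forall fun t => ?_
    rw [ContinuousLinearMap.mul_apply', norm_mul]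
    exact mul_le_mul_of_nonneg_left (hB _) (norm_nonneg _)
  · have hne : ∀ᵐ t : ℝ, t ≠ s := by simp [ae_iff, measure_singleton]
    filter_upwards [hne] with t ht
    simp only [ContinuousLinearMap.mul_apply']
    refine continuousAt_const.mul (ContinuousAt.comp (g := causalKernel c ε σ) ?_ (by fun_prop))
    exact hcont _ (sub_ne_zero.2 ht.symm)

theorem eq_zero_of_ae_eq_zero_of_continuousAt {g : ℝ → ℂ} (hg : ∀ᵐ s, g s = 0) {s : ℝ}
    (hs : ContinuousAt g s) : g s = 0 := by
  have hd : Dense {t : ℝ | g t = 0} := Measure.dense_of_ae hg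
  by_contra hne
  obtain ⟨t, ht, ht0⟩ := mem_closure_iff_nhds.1 (hd s) _ (hs.eventually_ne hne)
  exact ht ht0

end NonlocalImpedance

theorem mainTheorem3 (c ε σ : ℝ) (hc : 0 < c) (hε : 1 < ε) (hσ : 0 ≤ σ)
    (h : ℝ → ℝ) (f : ℝ → ℂ) (u : ℝ → ℝ → ℝ → ℂ) (x : ℝ)
    (hh : DifferentiableAt ℝ h x)
    (hpacket : NonlocalImpedance.IsCausalPacket f u h x) :
    -- the integrals in the kernel and in the boundary condition converge
    (∀ s : ℝ, IntervalIntegrable (NonlocalImpedance.kernelIntegrand c ε σ) volume 0 s) ∧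
    (∀ s : ℝ, IntervalIntegrable
      (fun η : ℝ => NonlocalImpedance.packetDerivS f u h x η *
        (NonlocalImpedance.memoryKernel c ε σ (s - η) : ℂ)) volume 0 s) ∧
    -- the frequency-domain and the time-domain conditions are equivalent
    ((∀ᵐ k : ℝ, f k ≠ 0 → NonlocalImpedance.ImpedanceCondition c ε σ h u x k) ↔
      ∀ᵐ s : ℝ, NonlocalImpedance.TimeDomainCondition c ε σ h f u x s) ∧
    -- the time-domain condition holds wherever both boundary derivatives are continuous
    ((∀ᵐ k : ℝ, f k ≠ 0 → NonlocalImpedance.ImpedanceCondition c ε σ h u x k) →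
      ∀ s : ℝ, ContinuousAt (fun s' : ℝ => NonlocalImpedance.packetDerivS f u h x s') s →
        ContinuousAt (fun s' : ℝ => NonlocalImpedance.packetDerivZ f u h x s') s →
        NonlocalImpedance.TimeDomainCondition c ε σ h f u x s) := by
  refine ⟨fun s => NonlocalImpedance.intervalIntegrable_kernelIntegrand c ε σ 0 s, fun s => ?_,
    hpacket.impedance_iff_timeDomain hc hε hσ, fun hA s hS hZ => ?_⟩
  · have := NonlocalImpedance.continuous_memoryKernel c ε σ
    exact hpacket.integrable_derivS.intervalIntegrable.mul_continuousOn (by fun_prop)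
  · rw [hpacket.timeDomainCondition_iff]
    refine NonlocalImpedance.eq_zero_of_ae_eq_zero_of_continuousAt ?_ ?_
    · filter_upwards [(hpacket.impedance_iff_timeDomain hc hε hσ).1 hA] with t ht
      exact (hpacket.timeDomainCondition_iff t).1 ht
    · have hN := (NonlocalImpedance.continuous_convolution_causalKernel hc hε hσ
        hpacket.integrable_derivS).continuousAt (x := s)
      exact (hZ.add (continuousAt_const.mul hS)).sub (continuousAt_const.mul (hS.sub hN))
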